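/- For positive integers $t \le s$ and an $s \times s$ $0$-$1$ matrix $M$ (a matrix over $\mathbb{F}_2$), let $N_t(M)$ be the number of $t \times t$ submatrices of $M$ (choices of $t$ columns and $t$ rows) that are invertible over $\mathbb{F}_2$, let $R_t(M) = N_t(M)/\binom{s}{t}^2$, and let $$R_t(s) = \max\{R_t(M) : M \text{ is an } s \times s \ 0\text{-}1 \text{ matrix that is invertible over } \mathbb{F}_2\}.$$ Then for every integer $s \ge 4$, $$R_2(s) \le \frac{5s}{8(s-1)}.$$ This upper bound tends to $5/8$ as $s \to \infty$; consequently $\limsup_{s\to\infty} R_2(s) \le 5/8$. -/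

import Mathlib

namespace AONT

/-- The `t`-element subsets of `{1, …, s}`. -/
abbrev IndexSubset (s t : ℕ) : Type := {I : Finset (Fin s) // I.card = t}

/-- The `t × t` submatrix `M(I, J)` of `M` with columns in `I` and rows in `J`
(both kept in increasing order). A 0-1 matrix is a matrix over `𝔽₂ = ZMod 2`. -/
def subMat {s t : ℕ} (M : Matrix (Fin s) (Fin s) (ZMod 2)) (I J : IndexSubset s t) :
    Matrix (Fin t) (Fin t) (ZMod 2) :=
  M.submatrix (J.1.orderEmbOfFin J.2) (I.1.orderEmbOfFin I.2)

open Classical in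
/-- `N_t(M)`: the number of `t × t` submatrices of `M` that are invertible over `𝔽₂`. -/
noncomputable def numInvertible {s : ℕ} (t : ℕ) (M : Matrix (Fin s) (Fin s) (ZMod 2)) : ℕ :=
  (Finset.univ.filter
    (fun p : IndexSubset s t × IndexSubset s t => IsUnit (subMat M p.1 p.2))).card

/-- The `t`-density `R_t(M) = N_t(M) / (s choose t)²`. -/
noncomputable def density {s : ℕ} (t : ℕ) (M : Matrix (Fin s) (Fin s) (ZMod 2)) : ℝ :=
  (numInvertible t M : ℝ) / (s.choose t : ℝ) ^ 2

/-- `R_t(s)`: the maximum `t`-density of an `s × s` matrix that is invertible over `𝔽₂`. -/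
noncomputable def maxDensity (t s : ℕ) : ℝ :=
  sSup {r : ℝ | ∃ M : Matrix (Fin s) (Fin s) (ZMod 2), IsUnit M ∧ r = density t M}

/-- The supremum in `maxDensity` is an attained maximum. -/
theorem isGreatest_maxDensity (t s : ℕ) :
    IsGreatest {r : ℝ | ∃ M : Matrix (Fin s) (Fin s) (ZMod 2), IsUnit M ∧ r = density t M}
      (maxDensity t s) := by
  have hfin : {r : ℝ | ∃ M : Matrix (Fin s) (Fin s) (ZMod 2),
      IsUnit M ∧ r = density t M}.Finite := by
    refine (Set.finite_range
      (fun M : Matrix (Fin s) (Fin s) (ZMod 2) => density t M)).subset ?_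
    rintro r ⟨M, -, rfl⟩
    exact ⟨M, rfl⟩
  exact ⟨Set.Nonempty.csSup_mem ⟨_, 1, isUnit_one, rfl⟩ hfin,
    fun r hr => le_csSup hfin.bddAbove hr⟩

end AONT

namespace AONT

open Finset

/-! A 2 × 2 minor over 𝔽₂ is nonzero exactly when one of `ad`, `bc` is 1, a real polynomial
condition on the entries. Let T be the number of ones, λ_ij the row overlaps and P = ∑ λ_ij²
replaced by first moments: P = ∑ λ_ij = ∑ (column weight)². Summing the indicator gives 2N ≤ T² − ∑
λ_ij² (`two_mul_numInvertible_le`). As λ_ii is a row weight, Cauchy–Schwarz on and off the diagonal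
bounds ∑ λ_ij² below in terms of T and P (`sum_rowOverlap_sq_ge`), and P ≥ T²/s. What remains is to
maximise over T: `density_polynomial_bound` for s ≥ 5, and integrality of column weights for s = 4.
-/

/-- The real 0-1 matrix with the same entries as `M`. -/
def realEntry {s : ℕ} (M : Matrix (Fin s) (Fin s) (ZMod 2)) (i c : Fin s) : ℝ :=
  ((M i c).val : ℝ)

/-- The indicator of `a * d - b * c ≠ 0`, as a polynomial in 0-1 entries. -/
def minorIndicator (a b c d : ℝ) : ℝ := a * d + b * c - 2 * (a * b * c * d)

theorem minorIndicator_nonneg (a b c d : ZMod 2) :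
    0 ≤ minorIndicator (a.val : ℝ) (b.val : ℝ) (c.val : ℝ) (d.val : ℝ) := by
  have h : ∀ a b c d : ZMod 2,
      2 * (a.val * b.val * c.val * d.val) ≤ a.val * d.val + b.val * c.val := by decide
  have h' : ((2 * (a.val * b.val * c.val * d.val) : ℕ) : ℝ)
      ≤ ((a.val * d.val + b.val * c.val : ℕ) : ℝ) := by exact_mod_cast h a b c d
  push_cast at h'
  unfold minorIndicator
  linarith

theorem one_le_minorIndicator {a b c d : ZMod 2} (hdet : a * d - b * c ≠ 0) :
    1 ≤ minorIndicator (a.val : ℝ) (b.val : ℝ) (c.val : ℝ) (d.val : ℝ) := by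
  have h : ∀ a b c d : ZMod 2, a * d - b * c ≠ 0 →
      1 + 2 * (a.val * b.val * c.val * d.val) ≤ a.val * d.val + b.val * c.val := by decide
  have h' : ((1 + 2 * (a.val * b.val * c.val * d.val) : ℕ) : ℝ)
      ≤ ((a.val * d.val + b.val * c.val : ℕ) : ℝ) := by exact_mod_cast h a b c d hdet
  push_cast at h'
  unfold minorIndicator
  linarith

/-- The set of ordered pairs of rows and ordered pairs of columns with nonzero minor. -/
def nonzeroMinors {s : ℕ} (M : Matrix (Fin s) (Fin s) (ZMod 2)) :
    Finset ((Fin s × Fin s) × (Fin s × Fin s)) :=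
  univ.filter fun q => M q.1.1 q.2.1 * M q.1.2 q.2.2 - M q.1.1 q.2.2 * M q.1.2 q.2.1 ≠ 0

/-- An ordered listing of a two-element subset, starting at its `a`-th element. -/
def orderedPair {s : ℕ} (I : IndexSubset s 2) (a : Fin 2) : Fin s × Fin s :=
  (I.1.orderEmbOfFin I.2 a, I.1.orderEmbOfFin I.2 (a + 1))

theorem orderedPair_injective {s : ℕ} {I J : IndexSubset s 2} {a b : Fin 2}
    (h : orderedPair I a = orderedPair J b) : I = J ∧ a = b := by
  have himage : ∀ (K : IndexSubset s 2) (c : Fin 2),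
      K.1 = {(orderedPair K c).1, (orderedPair K c).2} := by
    intro K c
    have h1 : K.1 = univ.image (K.1.orderEmbOfFin K.2) := by
      rw [← Finset.coe_inj]; simp
    rw [h1]
    ext x
    simp only [mem_image, mem_univ, true_and, mem_insert, mem_singleton, orderedPair,
      Fin.exists_fin_two]
    fin_cases c <;> simp [eq_comm, or_comm]
  have hIJ : I = J := by
    apply Subtype.ext
    rw [himage I a, himage J b, h]
  subst hIJ
  exact ⟨rfl, (I.1.orderEmbOfFin I.2).injective (congrArg Prod.fst h)⟩

/-- Each invertible submatrix is listed four times, once for each ordering of its two rows and of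
its two columns. -/
theorem four_mul_numInvertible_le_card {s : ℕ} (M : Matrix (Fin s) (Fin s) (ZMod 2)) :
    4 * numInvertible 2 M ≤ (nonzeroMinors M).card := by
  classical
  let S := (univ.filter
    (fun p : IndexSubset s 2 × IndexSubset s 2 => IsUnit (subMat M p.1 p.2)))
      ×ˢ (univ : Finset (Fin 2 × Fin 2))
  have hS : S.card = 4 * numInvertible 2 M := by
    simp only [S, card_product, numInvertible, card_univ, Fintype.card_prod, Fintype.card_fin]
    rw [mul_comm]
  rw [← hS]
  refine card_le_card_of_injOn
    (fun q => (orderedPair q.1.2 q.2.1, orderedPair q.1.1 q.2.2)) ?_ ?_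
  · rintro ⟨⟨I, J⟩, a, b⟩ hq
    have hu : IsUnit (subMat M I J) := by simpa [S] using hq
    rw [Matrix.isUnit_iff_isUnit_det, isUnit_iff_ne_zero, Matrix.det_fin_two] at hu
    simp only [subMat, Matrix.submatrix_apply] at hu
    simp only [nonzeroMinors, coe_filter, mem_univ, true_and, Set.mem_ofPred_eq, orderedPair]
    intro h0
    apply hu
    -- Swapping the rows or the columns only changes the sign of the minor.
    fin_cases a <;> fin_cases b <;>
      simp only [Fin.zero_eta, Fin.mk_one, zero_add, Fin.isValue, Fin.reduceAdd] at h0 <;>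
      first
        | linear_combination h0
        | linear_combination -h0
  · rintro ⟨⟨I, J⟩, a, b⟩ - ⟨⟨I', J'⟩, a', b'⟩ - h
    obtain ⟨h1, h2⟩ := Prod.mk.inj h
    obtain ⟨rfl, rfl⟩ := orderedPair_injective h1
    obtain ⟨rfl, rfl⟩ := orderedPair_injective h2
    rfl

/-- The number of ones in row `i`. -/
def rowWeight {s : ℕ} (M : Matrix (Fin s) (Fin s) (ZMod 2)) (i : Fin s) : ℝ :=
  ∑ c, realEntry M i c

/-- The number of ones common to rows `i` and `j`. -/
def rowOverlap {s : ℕ} (M : Matrix (Fin s) (Fin s) (ZMod 2)) (i j : Fin s) : ℝ :=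
  ∑ c, realEntry M i c * realEntry M j c

/-- The number of ones in column `c`. -/
def colWeight {s : ℕ} (M : Matrix (Fin s) (Fin s) (ZMod 2)) (c : Fin s) : ℕ :=
  ∑ i, (M i c).val

theorem sum_minorIndicator {s : ℕ} (M : Matrix (Fin s) (Fin s) (ZMod 2)) (i j : Fin s) :
    ∑ c, ∑ d, minorIndicator (realEntry M i c) (realEntry M i d) (realEntry M j c)
      (realEntry M j d) = 2 * (rowWeight M i * rowWeight M j - rowOverlap M i j ^ 2) := by
  have h1 : rowWeight M i * rowWeight M j = ∑ c, ∑ d, realEntry M i c * realEntry M j d :=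
    Finset.sum_mul_sum _ _ _ _
  have h2 : rowWeight M i * rowWeight M j = ∑ c, ∑ d, realEntry M i d * realEntry M j c := by
    rw [h1, sum_comm]
  have h3 : rowOverlap M i j ^ 2 = ∑ c, ∑ d, realEntry M i c * realEntry M i d *
      realEntry M j c * realEntry M j d := by
    rw [sq, rowOverlap, Finset.sum_mul_sum]
    refine sum_congr rfl fun c _ => sum_congr rfl fun d _ => by ring
  have h4 : 2 * (rowWeight M i * rowWeight M j - rowOverlap M i j ^ 2) =
      rowWeight M i * rowWeight M j + rowWeight M i * rowWeight M j
        - 2 * rowOverlap M i j ^ 2 := by ring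
  rw [h4, h3]
  nth_rewrite 1 [h1]
  rw [h2]
  simp only [minorIndicator, sum_sub_distrib, sum_add_distrib, mul_sum]

theorem two_mul_numInvertible_le {s : ℕ} (M : Matrix (Fin s) (Fin s) (ZMod 2)) :
    2 * (numInvertible 2 M : ℝ) ≤ (∑ i, rowWeight M i) ^ 2 - ∑ i, ∑ j, rowOverlap M i j ^ 2 := by
  have h1 : (4 * numInvertible 2 M : ℝ) ≤ ((nonzeroMinors M).card : ℝ) := by
    exact_mod_cast four_mul_numInvertible_le_card M
  have h2 : ((nonzeroMinors M).card : ℝ) ≤ ∑ q : (Fin s × Fin s) × (Fin s × Fin s),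
      minorIndicator (realEntry M q.1.1 q.2.1) (realEntry M q.1.1 q.2.2)
        (realEntry M q.1.2 q.2.1) (realEntry M q.1.2 q.2.2) := by
    rw [card_eq_sum_ones, nonzeroMinors, sum_filter]
    push_cast
    refine sum_le_sum fun q _ => ?_
    split_ifs with h
    · exact one_le_minorIndicator h
    · exact minorIndicator_nonneg _ _ _ _
  have h3 : ∑ q : (Fin s × Fin s) × (Fin s × Fin s),
      minorIndicator (realEntry M q.1.1 q.2.1) (realEntry M q.1.1 q.2.2)
        (realEntry M q.1.2 q.2.1) (realEntry M q.1.2 q.2.2) =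
      2 * ((∑ i, rowWeight M i) ^ 2 - ∑ i, ∑ j, rowOverlap M i j ^ 2) := by
    simp only [Fintype.sum_prod_type, sum_minorIndicator]
    rw [sq, Finset.sum_mul_sum]
    simp only [← mul_sum, sum_sub_distrib]
  linarith

theorem rowOverlap_self {s : ℕ} (M : Matrix (Fin s) (Fin s) (ZMod 2)) (i : Fin s) :
    rowOverlap M i i = rowWeight M i := by
  have h : ∀ a : ZMod 2, a.val * a.val = a.val := by decide
  refine sum_congr rfl fun c _ => ?_
  simp only [realEntry]
  exact_mod_cast h (M i c)

theorem sum_rowWeight {s : ℕ} (M : Matrix (Fin s) (Fin s) (ZMod 2)) :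
    ∑ i, rowWeight M i = ∑ c, (colWeight M c : ℝ) := by
  simp only [rowWeight, colWeight, realEntry]
  push_cast
  exact sum_comm

/-- Both sides count triples of two rows and a column in which both rows have a one. -/
theorem sum_rowOverlap {s : ℕ} (M : Matrix (Fin s) (Fin s) (ZMod 2)) :
    ∑ i, ∑ j, rowOverlap M i j = ∑ c, (colWeight M c : ℝ) ^ 2 := by
  simp only [rowOverlap, colWeight, realEntry]
  push_cast
  simp only [sq, Finset.sum_mul_sum]
  rw [sum_comm' (t' := univ) (s' := fun _ => univ) (by simp)]
  rw [sum_congr rfl fun j _ => sum_comm, sum_comm]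
  refine sum_congr rfl fun c _ => ?_
  rw [sum_comm]

theorem colWeight_le {s : ℕ} (M : Matrix (Fin s) (Fin s) (ZMod 2)) (c : Fin s) :
    colWeight M c ≤ s := by
  have h : ∀ a : ZMod 2, a.val ≤ 1 := by decide
  calc colWeight M c ≤ ∑ _i : Fin s, 1 := sum_le_sum fun i _ => h _
    _ = s := by simp

/-- Cauchy–Schwarz, applied separately to the diagonal and off-diagonal entries. -/
theorem sum_rowOverlap_sq_ge {s : ℕ} (hs : 2 ≤ s) (M : Matrix (Fin s) (Fin s) (ZMod 2)) :
    (∑ i, rowWeight M i) ^ 2 / s +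
      (∑ c, (colWeight M c : ℝ) ^ 2 - ∑ i, rowWeight M i) ^ 2 / (s * (s - 1)) ≤
      ∑ i, ∑ j, rowOverlap M i j ^ 2 := by
  have hs' : (2 : ℝ) ≤ s := by exact_mod_cast hs
  have split : ∀ f : Fin s → Fin s → ℝ,
      ∑ i, ∑ j, f i j = ∑ i, f i i + ∑ p ∈ (univ : Finset (Fin s)).offDiag, f p.1 p.2 := by
    intro f
    rw [← Fintype.sum_prod_type', ← univ_product_univ, ← diag_union_offDiag,
      sum_union (disjoint_diag_offDiag _), sum_diag]
  have hdiag : (∑ i, rowWeight M i) ^ 2 ≤ s * ∑ i, rowWeight M i ^ 2 := by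
    simpa using sq_sum_le_card_mul_sum_sq (s := (univ : Finset (Fin s))) (f := rowWeight M)
  have hoff := sq_sum_le_card_mul_sum_sq (s := (univ : Finset (Fin s)).offDiag)
    (f := fun p => rowOverlap M p.1 p.2)
  have hcard : (((univ : Finset (Fin s)).offDiag.card : ℕ) : ℝ) = s * (s - 1) := by
    rw [offDiag_card, card_univ, Fintype.card_fin, Nat.cast_sub (Nat.le_mul_self s)]
    push_cast
    ring
  have hP := split (rowOverlap M)
  simp only [rowOverlap_self, sum_rowOverlap] at hP
  rw [hcard, show ∑ p ∈ (univ : Finset (Fin s)).offDiag, rowOverlap M p.1 p.2 =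
    ∑ c, (colWeight M c : ℝ) ^ 2 - ∑ i, rowWeight M i by linarith] at hoff
  rw [split fun i j => rowOverlap M i j ^ 2]
  simp only [rowOverlap_self]
  refine add_le_add ?_ ?_
  · rw [div_le_iff₀ (by linarith)]
    linarith
  · rw [div_le_iff₀ (by nlinarith)]
    linarith

theorem density_polynomial_bound {n T P : ℝ} (hn : 5 ≤ n) (hT : 0 ≤ T) (hT' : T ≤ n ^ 2)
    (hP : T ^ 2 ≤ n * P) :
    T ^ 2 - (T ^ 2 / n + (P - T) ^ 2 / (n * (n - 1))) ≤ 5 * n ^ 3 * (n - 1) / 16 := by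
  have hn0 : 0 < n := by linarith
  have hn1 : 0 < n - 1 := by linarith
  -- Normalise: `r` is the density of ones and `p` the mean off-diagonal overlap divided by `n`; the
  -- left side becomes n³(n − 1)(r² − p²).
  obtain ⟨r, rfl⟩ : ∃ r, T = r * n ^ 2 := ⟨T / n ^ 2, by field_simp⟩
  obtain ⟨p, rfl⟩ : ∃ p, P = p * n ^ 2 * (n - 1) + r * n ^ 2 :=
    ⟨(P - r * n ^ 2) / (n ^ 2 * (n - 1)), by field_simp; ring⟩
  have hr : 0 ≤ r := by
    by_contra! h
    nlinarith [mul_pos (neg_pos.mpr h) (pow_pos hn0 2)]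
  have hr1 : r ≤ 1 := by
    by_contra! h
    nlinarith [mul_pos (sub_pos.mpr h) (pow_pos hn0 2)]
  have hp : r ^ 2 * n ≤ p * (n - 1) + r := by
    have h3 : 0 < n ^ 3 := by positivity
    refine le_of_mul_le_mul_left ?_ h3
    linarith
  have hp' : r * (5 * r - 1) ≤ 4 * p := by
    refine le_of_mul_le_mul_right ?_ hn1
    -- The slack is r(1 − r)(n − 5), so n = 5 is the worst case.
    nlinarith [mul_nonneg (mul_nonneg hr (sub_nonneg.mpr hr1)) (sub_nonneg.mpr hn)]
  have key : r ^ 2 - p ^ 2 ≤ 5 / 16 := by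
    rcases le_total (5 * r) 1 with h | h
    · nlinarith [sq_nonneg p]
    · have h0 : 0 ≤ r * (5 * r - 1) := mul_nonneg hr (by linarith)
      have h1 : (r * (5 * r - 1)) ^ 2 ≤ (4 * p) ^ 2 := pow_le_pow_left₀ h0 hp' 2
      -- 5 − 16r² + r²(5r − 1)² = 25(r² − r/5 − 2/5)² + 4(r − 1/2)².
      nlinarith [sq_nonneg (r ^ 2 - r / 5 - 2 / 5), sq_nonneg (r - 1 / 2)]
  have e : (r * n ^ 2) ^ 2 - ((r * n ^ 2) ^ 2 / n +
      (p * n ^ 2 * (n - 1) + r * n ^ 2 - r * n ^ 2) ^ 2 / (n * (n - 1))) =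
      n ^ 3 * (n - 1) * (r ^ 2 - p ^ 2) := by
    field_simp
    ring
  rw [e]
  have : 0 < n ^ 3 * (n - 1) := by positivity
  nlinarith [mul_le_mul_of_nonneg_left key this.le]

/-- With only P ≥ T²/4 the bound fails for some real T just below 12. The two linear bounds on P
meet at T = 12, where equality is possible. -/
theorem density_polynomial_bound_four {T P : ℝ} (hT : 0 ≤ T)
    (h1 : 5 * T - 24 ≤ P) (h2 : 7 * T - 48 ≤ P) :
    T ^ 2 - (T ^ 2 / 4 + (P - T) ^ 2 / (4 * (4 - 1))) ≤ 5 * 4 ^ 3 * (4 - 1) / 16 := by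
  rcases le_total T 6 with h | h
  · nlinarith [sq_nonneg (P - T)]
  · rcases le_total T 12 with h' | h'
    · have := pow_le_pow_left₀ (by linarith : 0 ≤ 4 * T - 24)
        (by linarith : 4 * T - 24 ≤ P - T) 2
      nlinarith [mul_nonneg (sub_nonneg.mpr h) (sub_nonneg.mpr h')]
    · have := pow_le_pow_left₀ (by linarith : 0 ≤ 6 * T - 48)
        (by linarith : 6 * T - 48 ≤ P - T) 2
      nlinarith [mul_nonneg (sub_nonneg.mpr h) (sub_nonneg.mpr h')]

theorem numInvertible_two_le {s : ℕ} (hs : 4 ≤ s) (M : Matrix (Fin s) (Fin s) (ZMod 2)) :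
    2 * (numInvertible 2 M : ℝ) ≤ 5 * (s : ℝ) ^ 3 * (s - 1) / 16 := by
  refine (two_mul_numInvertible_le M).trans
    ((sub_le_sub_left (sum_rowOverlap_sq_ge (by omega) M) _).trans ?_)
  rw [sum_rowWeight]
  have hT : 0 ≤ ∑ c, (colWeight M c : ℝ) := sum_nonneg fun c _ => Nat.cast_nonneg _
  obtain rfl | hs5 := hs.eq_or_lt
  -- No integer lies strictly between m and m + 1, so (k − m)(k − m − 1) ≥ 0 for a column weight k;
  -- used with m = 2, 3.
  · have hk (m : ℕ) (c : Fin 4) :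
        (2 * m + 1) * (colWeight M c : ℝ) - m * (m + 1) ≤ (colWeight M c : ℝ) ^ 2 := by
      have h : (0 : ℝ) ≤ ((colWeight M c : ℝ) - m) * ((colWeight M c : ℝ) - (m + 1)) := by
        rcases Nat.lt_or_ge m (colWeight M c) with h | h
        · have h' : (m : ℝ) + 1 ≤ colWeight M c := by exact_mod_cast h
          exact mul_nonneg (by linarith) (by linarith)
        · have h' : (colWeight M c : ℝ) ≤ m := by exact_mod_cast h
          exact mul_nonneg_of_nonpos_of_nonpos (by linarith) (by linarith)
      linarith
    have hsum (m : ℕ) := sum_le_sum fun c (_ : c ∈ univ) => hk m c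
    simp only [sum_sub_distrib, ← mul_sum, sum_const, card_univ, Fintype.card_fin,
      nsmul_eq_mul] at hsum
    have h2 := hsum 2
    have h3 := hsum 3
    norm_num at h2 h3
    simp only [Nat.cast_ofNat]
    exact density_polynomial_bound_four hT (by linarith) (by linarith)
  · refine density_polynomial_bound (by exact_mod_cast hs5) hT ?_ ?_
    · calc ∑ c, (colWeight M c : ℝ) ≤ ∑ _c : Fin s, (s : ℝ) :=
            sum_le_sum fun c _ => by exact_mod_cast colWeight_le M c
        _ = (s : ℝ) ^ 2 := by simp [sq]
    · simpa using sq_sum_le_card_mul_sum_sq (s := (univ : Finset (Fin s)))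
        (f := fun c => (colWeight M c : ℝ))

theorem maxDensity_two_le {s : ℕ} (hs : 4 ≤ s) :
    maxDensity 2 s ≤ 5 * (s : ℝ) / (8 * ((s : ℝ) - 1)) := by
  obtain ⟨M, -, hM⟩ := (isGreatest_maxDensity 2 s).1
  have hs' : (4 : ℝ) ≤ s := by exact_mod_cast hs
  have h1 : (0 : ℝ) < s - 1 := by linarith
  have h0 : (0 : ℝ) < s := by linarith
  rw [hM, density, Nat.cast_choose_two, div_le_div_iff₀ (by positivity) (by positivity)]
  have h := mul_le_mul_of_nonneg_right (numInvertible_two_le hs M) h1.le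
  linarith

theorem tendsto_upper_bound :
    Filter.Tendsto (fun s : ℕ => 5 * (s : ℝ) / (8 * ((s : ℝ) - 1))) Filter.atTop
      (nhds (5 / 8)) := by
  have h : Filter.Tendsto (fun s : ℕ => (5 / 8 : ℝ) * ((s : ℝ) / ((s : ℝ) + (-1)))) Filter.atTop
      (nhds (5 / 8 * 1)) := (tendsto_natCast_div_add_atTop (-1 : ℝ)).const_mul _
  rw [mul_one] at h
  refine h.congr fun s => ?_
  rw [div_mul_div_comm, sub_eq_add_neg]

end AONT

theorem mainTheorem6 :
    (∀ s : ℕ, 4 ≤ s → AONT.maxDensity 2 s ≤ 5 * (s : ℝ) / (8 * ((s : ℝ) - 1))) ∧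
    Filter.Tendsto (fun s : ℕ => 5 * (s : ℝ) / (8 * ((s : ℝ) - 1))) Filter.atTop
      (nhds (5 / 8)) ∧
    Filter.limsup (fun s : ℕ => ((AONT.maxDensity 2 s : ℝ) : EReal)) Filter.atTop
      ≤ ((5 / 8 : ℝ) : EReal) := by
  refine ⟨fun s hs => AONT.maxDensity_two_le hs, AONT.tendsto_upper_bound, ?_⟩
  have hlim := (continuous_coe_real_ereal.tendsto (5 / 8)).comp AONT.tendsto_upper_bound
  rw [← hlim.limsup_eq]
  refine Filter.limsup_le_limsup ?_
  filter_upwards [Filter.eventually_ge_atTop 4] with s hs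
  exact EReal.coe_le_coe_iff.mpr (AONT.maxDensity_two_le hs)
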